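/- Let $\Sigma$ be an alphabet and let $T\in\Sigma^n$. An LZ-style factorization writes $T=f_1\cdots f_z$ with non-empty phrases $f_k$, each of which is either a fresh character not occurring in $f_1\cdots f_{k-1}$ or a copy of an earlier substring. In the \emph{overlapping LZSS} factorization, each copied phrase $f_k$ is the longest prefix of $f_k f_{k+1}\cdots f_z$ that has an occurrence in $T$ starting before position $|f_1\cdots f_{k-1}|+1$ (the occurrence may overlap $f_k$); in the \emph{non-overlapping LZSS} factorization, each copied phrase $f_k$ is the longest prefix of $f_k f_{k+1}\cdots f_z$ that occurs in $f_1\cdots f_{k-1}$. Each factorization exists and is unique; let $z_{\mathrm{SSsr}}(T)$ and $z_{\mathrm{SS}}(T)$, respectively, be its number of phrases. For a measure $c$ and an edit type $\mathrm{edit}\in\{\mathrm{sub},\mathrm{ins},\mathrm{del}\}$, let $$\mathrm{AS}_{\mathrm{edit}}(c,n)=\max\{c(T')-c(T)\}$$ over all $T\in\Sigma^n$ and all $T'$ obtained from $T$ by a single-character edit operation of that type: substitution of a character by a different one, insertion of a character, or deletion of a character, respectively. (If there is no such pair $T,T'$, the value is taken to be $0$.) Theorem. For every $\mathrm{edit}\in\{\mathrm{sub},\mathrm{ins},\mathrm{del}\}$,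 $$\mathrm{AS}_{\mathrm{edit}}(z_{\mathrm{SSsr}},n)=O(n^{2/3})\quad\text{and}\quad \mathrm{AS}_{\mathrm{edit}}(z_{\mathrm{SS}},n)=O(n^{2/3}).$$ More precisely, there is an absolute constant $C$, independent of the alphabet $\Sigma$ (which may be infinite), such that for all $n\ge 1$ and all three edit types these maxima exist (whenever there is a pair $T,T'$ as above) and are at most $C\,n^{2/3}$ in absolute value. -/

import Mathlib

/-- The two versions of the LZSS factorization: sources that may overlap their copies, and
sources that may not. -/
inductive LZVariant
  | overlapping
  | nonOverlapping

/-- The three types of single-character edit operations. -/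
inductive EditType
  | sub
  | ins
  | del

/-- `IsCopy V pre f`: the string `f`, read right after the prefix `pre`, is a copy of an earlier
substring. Overlapping version: `f` occurs in `pre ++ f` at another place than the end, i.e. it
occurs at least twice in `pre ++ f`. Non-overlapping version: `f` occurs in `pre`. -/
def IsCopy {α : Type*} : LZVariant → List α → List α → Prop
  | .overlapping, pre, f => ∃ u v : List α, v ≠ [] ∧ u ++ f ++ v = pre ++ f
  | .nonOverlapping, pre, f => ∃ u v : List α, u ++ f ++ v = pre

/-- `f` is the greedy phrase of the text `pre ++ rest` at the beginning of `rest`: either a fresh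
character, not occurring in `pre`, or the longest non-empty prefix of `rest` that is a copy. -/
def IsLZSSPhrase {α : Type*} (V : LZVariant) (pre rest f : List α) : Prop :=
  (∃ a : α, f = [a] ∧ f <+: rest ∧ a ∉ pre) ∨
  (f ≠ [] ∧ f <+: rest ∧ IsCopy V pre f ∧
    ∀ g : List α, g <+: rest → IsCopy V pre g → g.length ≤ f.length)

/-- The strings in the list `fs` are successive greedy phrases when read after `pre`. -/
def IsLZSSFrom {α : Type*} (V : LZVariant) : List α → List (List α) → Prop
  | _, [] => True
  | pre, f :: fs => IsLZSSPhrase V pre (f ++ fs.flatten) f ∧ IsLZSSFrom V (pre ++ f) fs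

/-- `fs` is the LZSS factorization of `T`. -/
def IsLZSS {α : Type*} (V : LZVariant) (T : List α) (fs : List (List α)) : Prop :=
  fs.flatten = T ∧ IsLZSSFrom V [] fs

theorem isCopy_singleton {α : Type*} (V : LZVariant) {pre : List α} {a : α} (h : a ∈ pre) :
    IsCopy V pre [a] := by
  obtain ⟨s, t, rfl⟩ := List.append_of_mem h
  cases V with
  | overlapping => exact ⟨s, t ++ [a], by simp, by simp⟩
  | nonOverlapping => exact ⟨s, t, by simp⟩

theorem not_isCopy_of_fresh {α : Type*} (V : LZVariant) {pre g : List α} {a : α}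
    (h : a ∉ pre) : ¬ IsCopy V pre (a :: g) := by
  intro hc
  cases V with
  | nonOverlapping =>
    obtain ⟨u, v, rfl⟩ := hc
    simp at h
  | overlapping =>
    obtain ⟨u, v, hv, e⟩ := hc
    have hl := congrArg List.length e
    have hv' : 0 < v.length := List.length_pos_iff.2 hv
    simp only [List.length_append, List.length_cons] at hl
    have hlt : u.length < pre.length := by omega
    have h1 : (u ++ a :: g ++ v)[u.length]? = some a := by simp
    rw [e, List.getElem?_append_left hlt] at h1
    exact h (List.mem_of_getElem? h1)

theorem exists_isLZSSPhrase {α : Type*} (V : LZVariant) (pre : List α) {rest : List α}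
    (hr : rest ≠ []) : ∃ f, IsLZSSPhrase V pre rest f := by
  classical
  obtain ⟨a, r, rfl⟩ := List.exists_cons_of_ne_nil hr
  by_cases ha : a ∈ pre
  · let P : ℕ → Prop := fun k => IsCopy V pre ((a :: r).take k)
    have h1 : P 1 := by simpa [P] using isCopy_singleton V ha
    have hb : 1 ≤ (a :: r).length := by simp
    have hP : P (Nat.findGreatest P (a :: r).length) := Nat.findGreatest_spec hb h1
    have h1k : 1 ≤ Nat.findGreatest P (a :: r).length := Nat.le_findGreatest hb h1
    have hk := Nat.findGreatest_le (P := P) (a :: r).length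
    refine ⟨(a :: r).take (Nat.findGreatest P (a :: r).length), Or.inr
      ⟨?_, List.take_prefix _ _, hP, ?_⟩⟩
    · intro h0
      have := congrArg List.length h0
      rw [List.length_take, List.length_nil] at this
      omega
    · intro g hg hgc
      rw [List.length_take, min_eq_left hk]
      refine Nat.le_findGreatest hg.length_le ?_
      change IsCopy V pre _
      rw [← List.prefix_iff_eq_take.1 hg]
      exact hgc
  · exact ⟨[a], Or.inl ⟨a, rfl, by simp, ha⟩⟩

theorem IsLZSSPhrase.unique {α : Type*} {V : LZVariant} {pre rest f g : List α}
    (hf : IsLZSSPhrase V pre rest f) (hg : IsLZSSPhrase V pre rest g) : f = g := by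
  have key : ∀ {a : α} {h : List α}, [a] <+: rest → a ∉ pre → h ≠ [] → h <+: rest →
      ¬ IsCopy V pre h := by
    intro a h h1 h2 h3 h4
    obtain ⟨b, h, rfl⟩ := List.exists_cons_of_ne_nil h3
    obtain ⟨s, rfl⟩ := h1
    obtain ⟨t, ht⟩ := h4
    simp only [List.cons_append, List.cons.injEq] at ht
    rw [ht.1]
    exact not_isCopy_of_fresh V h2
  rcases hf with ⟨a, rfl, h1, h2⟩ | ⟨h1, h2, h3, h4⟩
  · rcases hg with ⟨b, rfl, h5, -⟩ | ⟨h5, h6, h7, -⟩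
    · exact (List.prefix_of_prefix_length_le h1 h5 (by simp)).eq_of_length (by simp)
    · exact absurd h7 (key h1 h2 h5 h6)
  · rcases hg with ⟨b, rfl, h5, h6⟩ | ⟨-, h6, h7, h8⟩
    · exact absurd h3 (key h5 h6 h1 h2)
    · have e : f.length = g.length := le_antisymm (h8 f h2 h3) (h4 g h6 h7)
      exact (List.prefix_of_prefix_length_le h2 h6 e.le).eq_of_length e

theorem IsLZSSPhrase.ne_nil {α : Type*} {V : LZVariant} {pre rest f : List α}
    (hf : IsLZSSPhrase V pre rest f) : f ≠ [] := by
  rcases hf with ⟨a, rfl, -⟩ | ⟨h, -⟩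
  · simp
  · exact h

theorem IsLZSSPhrase.isPrefix {α : Type*} {V : LZVariant} {pre rest f : List α}
    (hf : IsLZSSPhrase V pre rest f) : f <+: rest := by
  rcases hf with ⟨a, -, h, -⟩ | ⟨-, h, -⟩ <;> exact h

theorem exists_isLZSSFrom {α : Type*} (V : LZVariant) (n : ℕ) : ∀ pre rest : List α,
    rest.length ≤ n → ∃ fs : List (List α), fs.flatten = rest ∧ IsLZSSFrom V pre fs := by
  induction n with
  | zero =>
    intro pre rest h
    have : rest = [] := List.length_eq_zero_iff.1 (by omega)
    exact ⟨[], by simp [this], trivial⟩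
  | succ n ih =>
    intro pre rest h
    by_cases hr : rest = []
    · exact ⟨[], by simp [hr], trivial⟩
    · obtain ⟨f, hf⟩ := exists_isLZSSPhrase V pre hr
      obtain ⟨s, rfl⟩ := hf.isPrefix
      have := List.length_pos_iff.2 hf.ne_nil
      obtain ⟨fs, rfl, h2⟩ := ih (pre ++ f) s (by rw [List.length_append] at h; omega)
      exact ⟨f :: fs, by simp, hf, h2⟩

theorem IsLZSSFrom.unique {α : Type*} {V : LZVariant} : ∀ {fs gs : List (List α)} {pre : List α},
    IsLZSSFrom V pre fs → IsLZSSFrom V pre gs → fs.flatten = gs.flatten → fs = gs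
  | [], [], _, _, _, _ => rfl
  | [], g :: gs, _, _, hg, e => by
    have := hg.1.ne_nil
    simp at e
    exact absurd e.1 this
  | f :: fs, [], _, hf, _, e => by
    have := hf.1.ne_nil
    simp at e
    exact absurd e.1 this
  | f :: fs, g :: gs, pre, hf, hg, e => by
    have e' : f ++ fs.flatten = g ++ gs.flatten := by simpa using e
    have h1 := hf.1
    rw [e'] at h1
    obtain rfl := h1.unique hg.1
    rw [IsLZSSFrom.unique hf.2 hg.2 (List.append_cancel_left e')]

/-- Every string has exactly one LZSS factorization (of either version). -/
theorem existsUnique_isLZSS {α : Type*} (V : LZVariant) (T : List α) : ∃! fs, IsLZSS V T fs := by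
  obtain ⟨fs, h1, h2⟩ := exists_isLZSSFrom V T.length [] T le_rfl
  exact ⟨fs, ⟨h1, h2⟩, fun gs hg => hg.2.unique h2 (hg.1.trans h1.symm)⟩

/-- The LZSS factorization of `T`. -/
noncomputable def lzss {α : Type*} (V : LZVariant) (T : List α) : List (List α) :=
  (existsUnique_isLZSS V T).choose

theorem lzss_spec {α : Type*} (V : LZVariant) (T : List α) : IsLZSS V T (lzss V T) :=
  (existsUnique_isLZSS V T).choose_spec.1

/-- The number of phrases in the LZSS factorization of `T`. -/
noncomputable def lzssSize {α : Type*} (V : LZVariant) (T : List α) : ℕ :=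
  (lzss V T).length

/-- `T'` is obtained from `T` by one single-character edit operation of the given type
(a substitution really changes the character), that is, `T'` is at edit distance `1` from `T`
and has length `|T|`, `|T| + 1`, `|T| - 1`, respectively. -/
def IsEdit {α : Type*} : EditType → List α → List α → Prop
  | .sub, T, T' => ∃ (u v : List α) (a b : α), a ≠ b ∧ T = u ++ a :: v ∧ T' = u ++ b :: v
  | .ins, T, T' => ∃ (u v : List α) (b : α), T = u ++ v ∧ T' = u ++ b :: v
  | .del, T, T' => ∃ (u v : List α) (a : α), T = u ++ a :: v ∧ T' = u ++ v

/-- The differences `c(T') - c(T)`, over all strings `T` of length `n` and all `T'` obtained from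
`T` by one edit operation of the given type. -/
def editDifferences {α : Type*} (e : EditType) (c : List α → ℕ) (n : ℕ) : Set ℤ :=
  {d | ∃ T T' : List α, T.length = n ∧ IsEdit e T T' ∧ d = (c T' : ℤ) - (c T : ℤ)}

/-- The worst-case additive sensitivity of the measure `c`. As this is a supremum of integers,
it is the maximum of the differences whenever these are bounded above and there is one. -/
noncomputable def additiveSensitivity {α : Type*} (e : EditType) (c : List α → ℕ) (n : ℕ) : ℤ :=
  sSup (editDifferences e c n)

/-!
The greedy factorization is a shortest one among all factorizations into single characters and
copies (`IsLZSSFrom.length_le`), because a part of a copy is again a copy. So it suffices to turn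
the factorization of `T = u ++ x ++ v` into a factorization of `T' = u ++ y ++ v` with few
additional phrases; here `x` and `y` have length at most one.

Cut the phrases of `T` at the two borders of `x`. The phrases of `u` remain valid in `T'`. A phrase
of `v` remains valid unless all its sources cross `x`; such a phrase falls into three valid pieces:
one copied from `u`, one of length at most one, and one copied from `v`. It also remains
valid if the same string already occurs in the part of `v` that has been read. Hence only the
first occurrences of distinct crossing strings cost anything (`IsLZStyle.transfer`).

A crossing string is determined by its length and by the place where `x` cuts it, so there are at
most `ℓ` of them of length `ℓ`, while their total length is at most `n`. Those of length at most
`L` number at most `L ^ 2`, the longer ones at most `n / L`, and `L ≈ n ^ (1 / 3)` gives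
`O(n ^ (2 / 3))` (`card_crossing_le_rpow`).

The argument is symmetric in `x` and `y`, so the differences are bounded from both sides.
-/

/-! ### Copies -/

theorem isCopy_of_infix {α : Type*} (V : LZVariant) {pre f : List α} (hf : f ≠ [])
    (h : f <:+: pre) : IsCopy V pre f := by
  obtain ⟨s, t, rfl⟩ := h
  cases V with
  | overlapping => exact ⟨s, t ++ f, by simp [hf], by simp⟩
  | nonOverlapping => exact ⟨s, t, rfl⟩

theorem IsCopy.append_left {α : Type*} {V : LZVariant} {pre f : List α} (z : List α)
    (h : IsCopy V pre f) : IsCopy V (z ++ pre) f := by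
  cases V with
  | overlapping =>
    obtain ⟨s, t, ht, e⟩ := h
    exact ⟨z ++ s, t, ht, by simpa using e⟩
  | nonOverlapping =>
    obtain ⟨s, t, e⟩ := h
    exact ⟨z ++ s, t, by simpa using e⟩

theorem IsCopy.of_append_left {α : Type*} {V : LZVariant} {pre p g : List α}
    (h : IsCopy V pre (p ++ g)) : IsCopy V pre p := by
  cases V with
  | overlapping =>
    obtain ⟨s, t, ht, e⟩ := h
    have hl := congrArg List.length e
    have ht' : 0 < t.length := List.length_pos_iff.2 ht
    simp only [List.length_append] at hl
    have h1 : s ++ p <+: pre ++ p := by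
      refine List.prefix_of_prefix_length_le (l₃ := pre ++ (p ++ g)) ?_ ?_ ?_
      · exact ⟨g ++ t, by simpa using e⟩
      · exact ⟨g, by simp⟩
      · simp only [List.length_append]; omega
    obtain ⟨t', e'⟩ := h1
    refine ⟨s, t', ?_, e'⟩
    rintro rfl
    have := congrArg List.length e'
    simp only [List.length_append, List.length_nil] at this
    omega
  | nonOverlapping =>
    obtain ⟨s, t, e⟩ := h
    exact ⟨s, g ++ t, by simpa using e⟩

theorem IsCopy.of_append_right {α : Type*} {V : LZVariant} {pre p g : List α}
    (h : IsCopy V pre (p ++ g)) : IsCopy V (pre ++ p) g := by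
  cases V with
  | overlapping =>
    obtain ⟨s, t, ht, e⟩ := h
    exact ⟨s ++ p, t, ht, by simpa using e⟩
  | nonOverlapping =>
    obtain ⟨s, t, e⟩ := h
    exact ⟨s ++ p, t ++ p, by simp [← e]⟩

/-- A source of a copy in `z ++ w` is cut by the border between `z` and `w` into a part in `z` and
a part in `w`. -/
theorem IsCopy.exists_split {α : Type*} {V : LZVariant} {z w f : List α}
    (h : IsCopy V (z ++ w) f) :
    ∃ p q : List α, f = p ++ q ∧ p <:+: z ∧ (q = [] ∨ IsCopy V (w ++ p) q) := by
  have key : ∀ s t r : List α, s ++ f ++ t = z ++ r →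
      (∃ s', s' ++ f ++ t = r) ∨ (f <:+: z) ∨
        ∃ p q, f = p ++ q ∧ p <:+: z ∧ q ++ t = r := by
    intro s t r e
    rw [List.append_assoc, List.append_eq_append_iff] at e
    rcases e with ⟨a, rfl, e⟩ | ⟨a, rfl, e⟩
    · rw [List.append_eq_append_iff] at e
      rcases e with ⟨b, rfl, -⟩ | ⟨b, rfl, e⟩
      · exact Or.inr (Or.inl ⟨s, b, by simp⟩)
      · exact Or.inr (Or.inr ⟨a, b, rfl, ⟨s, [], by simp⟩, e.symm⟩)
    · exact Or.inl ⟨a, by simpa using e.symm⟩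
  cases V with
  | overlapping =>
    obtain ⟨s, t, ht, e⟩ := h
    rw [List.append_assoc z] at e
    rcases key s t _ e with ⟨s', e'⟩ | h' | ⟨p, q, rfl, hp, e'⟩
    · exact ⟨[], f, rfl, List.nil_infix, Or.inr ⟨s', t, ht, by simpa using e'⟩⟩
    · exact ⟨f, [], by simp, h', Or.inl rfl⟩
    · exact ⟨p, q, rfl, hp, Or.inr ⟨[], t, ht, by simpa using e'⟩⟩
  | nonOverlapping =>
    obtain ⟨s, t, e⟩ := h
    rcases key s t _ e with ⟨s', e'⟩ | h' | ⟨p, q, rfl, hp, e'⟩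
    · exact ⟨[], f, rfl, List.nil_infix, Or.inr ⟨s', t, by simpa using e'⟩⟩
    · exact ⟨f, [], by simp, h', Or.inl rfl⟩
    · exact ⟨p, q, rfl, hp, Or.inr ⟨[], t ++ p, by simp [← e']⟩⟩

/-! ### Factorizations that need not be greedy -/

/-- `f` is an admissible piece of a factorization when read after `pre`: a copy, or a string of
length at most one. Empty pieces and single characters that are not fresh are allowed. -/
def IsLZPiece {α : Type*} (V : LZVariant) (pre f : List α) : Prop :=
  f.length ≤ 1 ∨ IsCopy V pre f

/-- The strings in the list `fs` are successive admissible pieces when read after `pre`. -/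
def IsLZStyle {α : Type*} (V : LZVariant) : List α → List (List α) → Prop
  | _, [] => True
  | pre, f :: fs => IsLZPiece V pre f ∧ IsLZStyle V (pre ++ f) fs

theorem isLZPiece_of_infix {α : Type*} (V : LZVariant) {pre f : List α} (h : f <:+: pre) :
    IsLZPiece V pre f := by
  by_cases hf : f = []
  · exact Or.inl (by simp [hf])
  · exact Or.inr (isCopy_of_infix V hf h)

theorem IsLZPiece.of_append_left {α : Type*} {V : LZVariant} {pre p g : List α}
    (h : IsLZPiece V pre (p ++ g)) : IsLZPiece V pre p := by
  rcases h with h | h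
  · exact Or.inl (by rw [List.length_append] at h; omega)
  · exact Or.inr h.of_append_left

theorem IsLZPiece.of_append_right {α : Type*} {V : LZVariant} {pre p g : List α}
    (h : IsLZPiece V pre (p ++ g)) : IsLZPiece V (pre ++ p) g := by
  rcases h with h | h
  · exact Or.inl (by rw [List.length_append] at h; omega)
  · exact Or.inr h.of_append_right

theorem IsLZSSPhrase.isLZPiece {α : Type*} {V : LZVariant} {pre rest f : List α}
    (h : IsLZSSPhrase V pre rest f) : IsLZPiece V pre f := by
  rcases h with ⟨a, rfl, -⟩ | ⟨-, -, h, -⟩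
  · exact Or.inl (by simp)
  · exact Or.inr h

theorem IsLZSSFrom.isLZStyle {α : Type*} {V : LZVariant} : ∀ {fs : List (List α)} {pre : List α},
    IsLZSSFrom V pre fs → IsLZStyle V pre fs
  | [], _, _ => trivial
  | _ :: _, _, h => ⟨h.1.isLZPiece, h.2.isLZStyle⟩

theorem IsLZStyle.append {α : Type*} {V : LZVariant} : ∀ {fs gs : List (List α)} {pre : List α},
    IsLZStyle V pre fs → IsLZStyle V (pre ++ fs.flatten) gs → IsLZStyle V pre (fs ++ gs)
  | [], _, _, _, hg => by simpa using hg
  | _ :: _, _, _, hf, hg => ⟨hf.1, hf.2.append (by simpa using hg)⟩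

theorem IsLZStyle.exists_split {α : Type*} {V : LZVariant} :
    ∀ {gs : List (List α)} {pre w₁ w₂ : List α}, IsLZStyle V pre gs → gs.flatten = w₁ ++ w₂ →
      ∃ gs₁ gs₂ : List (List α), gs₁.flatten = w₁ ∧ gs₂.flatten = w₂ ∧ IsLZStyle V pre gs₁ ∧
        IsLZStyle V (pre ++ w₁) gs₂ ∧ gs₁.length + gs₂.length ≤ gs.length + 1
  | [], pre, w₁, w₂, _, e => by
    simp only [List.flatten_nil, List.nil_eq_append_iff] at e
    obtain ⟨rfl, rfl⟩ := e
    exact ⟨[], [], rfl, rfl, trivial, trivial, by simp⟩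
  | g :: gs, pre, w₁, w₂, h, e => by
    rw [List.flatten_cons, List.append_eq_append_iff] at e
    rcases e with ⟨a, rfl, e⟩ | ⟨a, rfl, rfl⟩
    · obtain ⟨gs₁, gs₂, rfl, h2, h3, h4, h5⟩ := h.2.exists_split e
      exact ⟨g :: gs₁, gs₂, by simp, h2, ⟨h.1, h3⟩, by simpa using h4, by
        simp only [List.length_cons]; omega⟩
    · refine ⟨[w₁], a :: gs, by simp, by simp, ⟨h.1.of_append_left, trivial⟩,
        ⟨h.1.of_append_right, by simpa using h.2⟩, ?_⟩
      simp only [List.length_cons, List.length_nil]; omega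

theorem IsLZSSPhrase.length_le_of_isLZPiece {α : Type*} {V : LZVariant} {pre rest f q : List α}
    (hf : IsLZSSPhrase V pre rest f) (hq : q <+: rest) (h : IsLZPiece V pre q) :
    q.length ≤ f.length := by
  have hpos := List.length_pos_iff.2 hf.ne_nil
  rcases h with h | h
  · omega
  rcases hf with ⟨a, rfl, ⟨r, rfl⟩, ha⟩ | ⟨-, -, -, hmax⟩
  · cases q with
    | nil => simp
    | cons b q =>
      obtain ⟨t, e⟩ := hq
      simp only [List.cons_append, List.cons.injEq] at e
      obtain ⟨rfl, -⟩ := e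
      exact absurd h (not_isCopy_of_fresh V ha)
  · exact hmax q hq h

/-- The greedy factorization stays ahead: if it has read `p` more than the factorization `gs`, it
needs at most as many further phrases. -/
theorem IsLZSSFrom.length_le {α : Type*} {V : LZVariant} :
    ∀ {gs fs : List (List α)} {pre p : List α}, IsLZSSFrom V (pre ++ p) fs →
      IsLZStyle V pre gs → p ++ fs.flatten = gs.flatten → fs.length ≤ gs.length
  | [], [], _, _, _, _, _ => le_rfl
  | _ :: _, [], _, _, _, _, _ => by simp
  | [], f :: fs, _, _, hf, _, e => by
    have := hf.1.ne_nil
    simp at e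
    exact absurd e.2.1 this
  | g :: gs, f :: fs, pre, p, hf, hg, e => by
    replace e := e.trans List.flatten_cons
    rw [List.append_eq_append_iff] at e
    rcases e with ⟨q, rfl, e⟩ | ⟨p', rfl, e⟩
    · -- The current piece ends after `p`, and greedy maximality makes `f` reach its end.
      have hle : q.length ≤ f.length := by
        refine hf.1.length_le_of_isLZPiece ?_ hg.1.of_append_right
        rw [← List.flatten_cons, e]
        exact List.prefix_append _ _
      rw [List.flatten_cons] at e
      obtain ⟨p', rfl⟩ : q <+: f :=
        List.prefix_of_prefix_length_le (l₃ := f ++ fs.flatten)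
          (e ▸ List.prefix_append _ _) (List.prefix_append _ _) hle
      have h2 : IsLZSSFrom V (pre ++ (p ++ q) ++ p') fs := by simpa using hf.2
      have := h2.length_le hg.2 (by simpa using e)
      simpa using this
    · have h2 : IsLZSSFrom V (pre ++ g ++ p') (f :: fs) := by simpa using hf
      exact (h2.length_le hg.2 e.symm).trans (by simp)

theorem lzssSize_le {α : Type*} {V : LZVariant} {gs : List (List α)} (h : IsLZStyle V [] gs) :
    lzssSize V gs.flatten ≤ gs.length := by
  obtain ⟨h1, h2⟩ := lzss_spec V gs.flatten
  exact IsLZSSFrom.length_le (p := []) h2 h (by simpa using h1)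

/-! ### Crossing strings -/

/-- `f` has an occurrence in `u ++ x ++ v` that crosses `x`: it starts before the end of `x` and
ends after the beginning of `x`. If `x` is empty, this means that the occurrence contains
characters of both `u` and `v`. -/
def IsCrossing {α : Type*} (u x v f : List α) : Prop :=
  ∃ a : ℕ, a < u.length + x.length ∧ u.length < a + f.length ∧ f <+: (u ++ x ++ v).drop a

/-- A piece whose source does not cross `x` remains an admissible piece when `x` is replaced. -/
theorem IsLZPiece.replace_or_isCrossing {α : Type*} {V : LZVariant} {u x w f : List α}
    (y : List α) (h : IsLZPiece V (u ++ x ++ w) f) (r : List α) :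
    IsLZPiece V (u ++ y ++ w) f ∨ IsCrossing u x (w ++ f ++ r) f := by
  by_cases hf : f.length ≤ 1
  · exact Or.inl (Or.inl hf)
  have hc : IsCopy V (u ++ x ++ w) f := h.resolve_left hf
  have right : ∀ s t z : List α, s ++ f ++ t = u ++ x ++ z → u.length + x.length ≤ s.length →
      ∃ s', s' ++ f ++ t = z := by
    intro s t z e hl
    have hp : u ++ x <+: s := by
      refine List.prefix_of_prefix_length_le (l₃ := u ++ x ++ z) (List.prefix_append _ _) ?_
        (by simpa using hl)
      exact ⟨f ++ t, by simpa using e⟩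
    obtain ⟨s', rfl⟩ := hp
    exact ⟨s', by simpa using e⟩
  have left : ∀ s t z : List α, s ++ f ++ t = u ++ z → s.length + f.length ≤ u.length →
      f <:+: u := by
    intro s t z e hl
    have hp : s ++ f <+: u :=
      List.prefix_of_prefix_length_le (l₃ := u ++ z) ⟨t, e⟩ (List.prefix_append _ _)
        (by simpa using hl)
    obtain ⟨t', rfl⟩ := hp
    exact ⟨s, t', rfl⟩
  have main : ∀ s t : List α, s ++ f ++ t = u ++ x ++ w ++ f → s.length < u.length + x.length →
      IsLZPiece V (u ++ y ++ w) f ∨ IsCrossing u x (w ++ f ++ r) f := by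
    intro s t e hl
    by_cases h1 : s.length + f.length ≤ u.length
    · left
      have := left s t (x ++ w ++ f) (by simpa using e) h1
      exact isLZPiece_of_infix V (this.trans ⟨[], y ++ w, by simp⟩)
    · right
      refine ⟨s.length, hl, by omega, ?_⟩
      have e2 : u ++ x ++ (w ++ f ++ r) = s ++ (f ++ t ++ r) := by
        calc _ = (u ++ x ++ w ++ f) ++ r := by simp
          _ = _ := by rw [← e]; simp
      rw [e2, List.drop_left]
      exact ⟨t ++ r, by simp⟩
  cases V with
  | overlapping =>
    obtain ⟨s, t, ht, e⟩ := hc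
    by_cases hl : s.length < u.length + x.length
    · exact main s t e hl
    · obtain ⟨s', e'⟩ := right s t (w ++ f) (by simpa using e) (by omega)
      have : IsCopy .overlapping w f := ⟨s', t, ht, e'⟩
      exact Or.inl (Or.inr (this.append_left (u ++ y)))
  | nonOverlapping =>
    obtain ⟨s, t, e⟩ := hc
    by_cases hl : s.length < u.length + x.length
    · exact main s (t ++ f) (by simp [← e]) hl
    · obtain ⟨s', e'⟩ := right s t w e (by omega)
      have : IsCopy .nonOverlapping w f := ⟨s', t, e'⟩
      exact Or.inl (Or.inr (this.append_left (u ++ y)))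

/-- Any piece falls into three pieces that are admissible after `x` is replaced: a part copied from
`u`, a part copied from `x`, of length at most one, and a part copied from `w`. -/
theorem IsLZPiece.exists_three {α : Type*} {V : LZVariant} {u x w f : List α} (y : List α)
    (hx : x.length ≤ 1) (h : IsLZPiece V (u ++ x ++ w) f) :
    ∃ f₁ f₂ f₃ : List α, f₁ ++ f₂ ++ f₃ = f ∧ IsLZStyle V (u ++ y ++ w) [f₁, f₂, f₃] := by
  rcases h with h | h
  · exact ⟨[], f, [], by simp, Or.inl (by simp), Or.inl h, Or.inl (by simp), trivial⟩
  obtain ⟨p, q, rfl, hp, hq⟩ := h.exists_split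
  obtain ⟨p₁, p₂, rfl, hp₁, hp₂⟩ :
      ∃ p₁ p₂ : List α, p = p₁ ++ p₂ ∧ p₁ <:+: u ∧ p₂.length ≤ 1 := by
    obtain ⟨s, t, e⟩ := hp
    rw [List.append_assoc, List.append_eq_append_iff] at e
    rcases e with ⟨a, rfl, e⟩ | ⟨a, rfl, rfl⟩
    · rw [List.append_eq_append_iff] at e
      rcases e with ⟨b, rfl, -⟩ | ⟨b, rfl, rfl⟩
      · exact ⟨p, [], by simp, ⟨s, b, by simp⟩, by simp⟩
      · refine ⟨a, b, rfl, ⟨s, [], by simp⟩, ?_⟩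
        rw [List.length_append] at hx; omega
    · refine ⟨[], p, rfl, List.nil_infix, ?_⟩
      simp only [List.length_append] at hx; omega
  refine ⟨p₁, p₂, q, rfl, isLZPiece_of_infix V (hp₁.trans ⟨[], y ++ w, by simp⟩), Or.inl hp₂, ?_,
    trivial⟩
  rcases hq with rfl | hq
  · exact Or.inl (by simp)
  · right
    simpa using hq.append_left (u ++ y)

/-- When `x` is replaced, a factorization of the text behind `x` needs at most two more pieces for
each string of a set `B` of crossing strings. A crossing piece has to be cut only if it does not
occur in the text `w` read since `x`, so each string counts once and the strings in `B` have total
length at most that of the text. -/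
theorem IsLZStyle.transfer {α : Type*} {V : LZVariant} {u x : List α} (y : List α)
    (hx : x.length ≤ 1) :
    ∀ {gs : List (List α)} {w : List α}, IsLZStyle V (u ++ x ++ w) gs →
      ∃ (hs : List (List α)) (B : Finset (List α)), IsLZStyle V (u ++ y ++ w) hs ∧
        hs.flatten = gs.flatten ∧ hs.length ≤ gs.length + 2 * B.card ∧
        ∑ b ∈ B, b.length ≤ gs.flatten.length ∧
        ∀ b ∈ B, ¬ b <:+: w ∧ IsCrossing u x (w ++ gs.flatten) b
  | [], w, _ => ⟨[], ∅, trivial, rfl, by simp, by simp, by simp⟩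
  | f :: gs, w, h => by
    classical
    have h2 : IsLZStyle V (u ++ x ++ (w ++ f)) gs := by simpa using h.2
    obtain ⟨hs, B, i1, i2, i3, i4, i5⟩ := h2.transfer y hx
    have i1' : IsLZStyle V (u ++ y ++ w ++ f) hs := by simpa using i1
    have i5' : ∀ b ∈ B, ¬ b <:+: w ∧ IsCrossing u x (w ++ (f :: gs).flatten) b := by
      intro b hb
      exact ⟨fun hw => (i5 b hb).1 (hw.trans ⟨[], f, by simp⟩), by simpa using (i5 b hb).2⟩
    by_cases hv : IsLZPiece V (u ++ y ++ w) f
    · refine ⟨f :: hs, B, ⟨hv, i1'⟩, by simp [i2], ?_, ?_, i5'⟩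
      · simp only [List.length_cons]; omega
      · rw [List.flatten_cons, List.length_append]; omega
    · have hfw : ¬ f <:+: w := fun hw =>
        hv (isLZPiece_of_infix V (hw.trans ⟨u ++ y, [], by simp⟩))
      have hcr := (h.1.replace_or_isCrossing y gs.flatten).resolve_left hv
      obtain ⟨f₁, f₂, f₃, rfl, hf⟩ := h.1.exists_three y hx
      have hB : f₁ ++ f₂ ++ f₃ ∉ B := fun hb => (i5 _ hb).1 ⟨w, [], by simp⟩
      refine ⟨[f₁, f₂, f₃] ++ hs, insert (f₁ ++ f₂ ++ f₃) B,
        hf.append (by simpa using i1'), by simp [i2], ?_, ?_, ?_⟩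
      · rw [Finset.card_insert_of_notMem hB]
        simp only [List.length_append, List.length_cons, List.length_nil]; omega
      · rw [Finset.sum_insert hB, List.flatten_cons, List.length_append (bs := gs.flatten)]; omega
      · intro b hb
        rcases Finset.mem_insert.1 hb with rfl | hb
        · exact ⟨hfw, by simpa using hcr⟩
        · exact i5' b hb

/-! ### Counting crossing strings -/

theorem card_crossing_le_sq {α : Type*} {u x v : List α} (hx : x.length ≤ 1) {L : ℕ}
    {B : Finset (List α)} (hB : ∀ b ∈ B, IsCrossing u x v b ∧ b.length ≤ L) :
    B.card ≤ L ^ 2 := by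
  classical
  choose! a h1 h2 h3 using fun b hb => (hB b hb).1
  have hcard : (Finset.Icc 1 L ×ˢ Finset.Icc 1 L).card = L ^ 2 := by
    simp [Finset.card_product, sq]
  rw [← hcard]
  -- The second component is the number of characters behind the beginning of `x`.
  refine Finset.card_le_card_of_injOn (fun b => (b.length, a b + b.length - u.length)) ?_ ?_
  · intro b hb
    have hb' : b ∈ B := hb
    have := h1 b hb'
    have := h2 b hb'
    have := (hB b hb').2
    simp only [Finset.coe_product, Set.mem_prod, Finset.coe_Icc, Set.mem_Icc]
    omega
  · intro b hb c hc e
    have hb' : b ∈ B := hb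
    have hc' : c ∈ B := hc
    simp only [Prod.mk.injEq] at e
    have e2 : a b = a c := by
      have := h2 b hb'
      have := h2 c hc'
      omega
    have hp := h3 b hb'
    rw [e2] at hp
    exact (List.prefix_of_prefix_length_le hp (h3 c hc') e.1.le).eq_of_length e.1

theorem card_crossing_le_rpow {α : Type*} {u x v : List α} (hx : x.length ≤ 1) {n : ℕ}
    (hn : 1 ≤ n) {B : Finset (List α)} (hB : ∀ b ∈ B, IsCrossing u x v b)
    (hsum : ∑ b ∈ B, b.length ≤ n) : (B.card : ℝ) ≤ 5 * (n : ℝ) ^ (2 / 3 : ℝ) := by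
  classical
  have hn' : (1 : ℝ) ≤ n := by exact_mod_cast hn
  have hn0 : (0 : ℝ) ≤ n := by linarith
  set r : ℝ := (n : ℝ) ^ (1 / 3 : ℝ) with hr
  have hr1 : 1 ≤ r := Real.one_le_rpow hn' (by norm_num)
  have hr2 : (n : ℝ) ^ (2 / 3 : ℝ) = r ^ 2 := by
    rw [hr, ← Real.rpow_natCast, ← Real.rpow_mul hn0]; norm_num
  have hr3 : (n : ℝ) = r ^ 3 := by
    rw [hr, ← Real.rpow_natCast, ← Real.rpow_mul hn0]; norm_num
  -- `L` balances the bounds for short and for long crossing strings.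
  set L : ℕ := ⌈r⌉₊ with hL
  have hL1 : r ≤ L := Nat.le_ceil r
  have hL2 : (L : ℝ) ≤ 2 * r := by
    have := Nat.ceil_lt_add_one (show 0 ≤ r by linarith)
    linarith
  have hshort : (B.filter (fun b => b.length ≤ L)).card ≤ L ^ 2 :=
    card_crossing_le_sq hx fun b hb =>
      ⟨hB b (Finset.mem_filter.1 hb).1, (Finset.mem_filter.1 hb).2⟩
  have hlong : (B.filter (fun b => ¬ b.length ≤ L)).card * L ≤ n := by
    calc (B.filter (fun b => ¬ b.length ≤ L)).card * L
        ≤ ∑ b ∈ B.filter (fun b => ¬ b.length ≤ L), b.length := by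
          rw [← smul_eq_mul]
          refine Finset.card_nsmul_le_sum _ _ _ fun b hb => ?_
          have := (Finset.mem_filter.1 hb).2
          omega
      _ ≤ ∑ b ∈ B, b.length := Finset.sum_le_sum_of_subset (Finset.filter_subset _ _)
      _ ≤ n := hsum
  have hsplit := Finset.card_filter_add_card_filter_not (s := B) (fun b => b.length ≤ L)
  generalize (B.filter (fun b => b.length ≤ L)).card = c₁ at *
  generalize (B.filter (fun b => ¬ b.length ≤ L)).card = c₂ at *
  have h1 : (c₁ : ℝ) ≤ 4 * r ^ 2 := by
    have : (c₁ : ℝ) ≤ (L : ℝ) ^ 2 := by exact_mod_cast hshort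
    nlinarith
  have h2 : (c₂ : ℝ) ≤ r ^ 2 := by
    have h3 : (c₂ : ℝ) * L ≤ r ^ 3 := by rw [← hr3]; exact_mod_cast hlong
    have h4 : (c₂ : ℝ) * r ≤ r ^ 2 * r := by
      calc (c₂ : ℝ) * r ≤ c₂ * L := by gcongr
        _ ≤ r ^ 3 := h3
        _ = r ^ 2 * r := by ring
    exact le_of_mul_le_mul_right h4 (by linarith)
  have h3 : (B.card : ℝ) = c₁ + c₂ := by exact_mod_cast hsplit.symm
  rw [hr2, h3]
  linarith

/-! ### Sensitivity -/

/-- Replacing a factor of length at most one by another one increases the number of phrases by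
`O(n ^ (2 / 3))`. -/
theorem lzssSize_replace_le {α : Type*} (V : LZVariant) {u v x y : List α} (hx : x.length ≤ 1)
    (hy : y.length ≤ 1) {n : ℕ} (hn : 1 ≤ n) (hv : v.length ≤ n) :
    (lzssSize V (u ++ y ++ v) : ℝ) ≤ lzssSize V (u ++ x ++ v) + 13 * (n : ℝ) ^ (2 / 3 : ℝ) := by
  obtain ⟨e, hT⟩ := lzss_spec V (u ++ x ++ v)
  obtain ⟨gs₁, gs', rfl, e', s1, s', l1⟩ :=
    hT.isLZStyle.exists_split (e.trans (List.append_assoc u x v))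
  obtain ⟨gs₂, gs₃, -, rfl, -, s3, l2⟩ := s'.exists_split e'
  obtain ⟨hs, B, t1, t2, t3, t4, t5⟩ :=
    IsLZStyle.transfer (u := gs₁.flatten) (x := x) (w := []) y hx (by simpa using s3)
  have hst : IsLZStyle V [] (gs₁ ++ y :: hs) :=
    s1.append ⟨Or.inl hy, by simpa using t1⟩
  have hle := lzssSize_le hst
  have hfl : (gs₁ ++ y :: hs).flatten = gs₁.flatten ++ y ++ gs₃.flatten := by simp [t2]
  rw [hfl] at hle
  have hcard := card_crossing_le_rpow hx hn (fun b hb => (t5 b hb).2) (t4.trans hv)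
  have hnat : lzssSize V (gs₁.flatten ++ y ++ gs₃.flatten) ≤
      lzssSize V (gs₁.flatten ++ x ++ gs₃.flatten) + 3 + 2 * B.card := by
    unfold lzssSize at hle ⊢
    simp only [List.length_append, List.length_cons] at hle
    omega
  have hreal : (lzssSize V (gs₁.flatten ++ y ++ gs₃.flatten) : ℝ) ≤
      lzssSize V (gs₁.flatten ++ x ++ gs₃.flatten) + 3 + 2 * B.card := by exact_mod_cast hnat
  have h1 : (1 : ℝ) ≤ (n : ℝ) ^ (2 / 3 : ℝ) :=
    Real.one_le_rpow (by exact_mod_cast hn) (by norm_num)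
  linarith

/-- Every single edit replaces a factor of length at most one by another one. -/
theorem IsEdit.exists_replace {α : Type*} {e : EditType} {T T' : List α} (h : IsEdit e T T') :
    ∃ u v x y : List α, x.length ≤ 1 ∧ y.length ≤ 1 ∧ T = u ++ x ++ v ∧ T' = u ++ y ++ v := by
  cases e with
  | sub =>
    obtain ⟨u, v, a, b, -, rfl, rfl⟩ := h
    exact ⟨u, v, [a], [b], by simp, by simp, by simp, by simp⟩
  | ins =>
    obtain ⟨u, v, b, rfl, rfl⟩ := h
    exact ⟨u, v, [], [b], by simp, by simp, by simp, by simp⟩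
  | del =>
    obtain ⟨u, v, a, rfl, rfl⟩ := h
    exact ⟨u, v, [a], [], by simp, by simp, by simp, by simp⟩

theorem abs_le_of_mem_editDifferences {α : Type*} {V : LZVariant} {e : EditType} {n : ℕ}
    (hn : 1 ≤ n) {d : ℤ} (hd : d ∈ editDifferences e (lzssSize (α := α) V) n) :
    |(d : ℝ)| ≤ 13 * (n : ℝ) ^ (2 / 3 : ℝ) := by
  obtain ⟨T, T', hT, hedit, rfl⟩ := hd
  obtain ⟨u, v, x, y, hx, hy, rfl, rfl⟩ := hedit.exists_replace
  have hv : v.length ≤ n := by simp only [List.length_append] at hT; omega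
  have h1 := lzssSize_replace_le V (u := u) hx hy hn hv
  have h2 := lzssSize_replace_le V (u := u) hy hx hn hv
  push_cast
  rw [abs_le]
  constructor <;> linarith

theorem mainTheorem4 :
    ∃ C : ℝ, ∀ (α : Type*) (V : LZVariant) (e : EditType) (n : ℕ), 1 ≤ n →
      BddAbove (editDifferences e (lzssSize (α := α) V) n) ∧
      |(additiveSensitivity e (lzssSize (α := α) V) n : ℝ)| ≤ C * (n : ℝ) ^ (2 / 3 : ℝ) := by
  refine ⟨13, fun α V e n hn => ?_⟩
  have hbdd : BddAbove (editDifferences e (lzssSize (α := α) V) n) := by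
    refine ⟨⌊13 * (n : ℝ) ^ (2 / 3 : ℝ)⌋, fun d hd => ?_⟩
    exact Int.le_floor.2 ((le_abs_self _).trans (abs_le_of_mem_editDifferences hn hd))
  refine ⟨hbdd, ?_⟩
  unfold additiveSensitivity
  rcases (editDifferences e (lzssSize (α := α) V) n).eq_empty_or_nonempty with h0 | h0
  · -- The supremum of the empty set of integers is `0`.
    rw [h0, Int.csSup_empty]
    simp only [Int.cast_zero, abs_zero]
    positivity
  · exact abs_le_of_mem_editDifferences hn (Int.csSup_mem h0 hbdd)
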